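/- **Definitions.** A topological space $F$ is a *quasicone* with apex $b\in F$ if there is a homotopy $H\colon F\times[0,1]\to F$ with $H(x,0)=x$ and $H(x,1)=b$ for every $x\in F$, and with $$H^{-1}(\{b\})=(\{b\}\times[0,1])\cup(F\times\{1\}).$$ A *marked space* $(X,B)$ is a topological space $X$ with a closed subset $B\subseteq X$ such that the points $b\in B$ admit pairwise disjoint closed neighbourhoods $F_b$ in $X$, where each $F_b$ is a quasicone with apex $b$. A singular simplex $\sigma\colon\Delta^n\to X$ is *admissible* if $\sigma^{-1}(B)$ is a (possibly empty) union of (not necessarily proper) faces of $\Delta^n$. Let $\mathcal R$ be a ring with unity. The free $\mathcal R$-modules on the admissible simplices form a subcomplex $\widehat C^{\mathcal M}_*(X,B;\mathcal R)$ of the singular chain complex $C_*(X;\mathcal R)$, and this subcomplex contains $C_*(B;\mathcal R)$. The *marked chain complex* is the quotient $$C^{\mathcal M}_*(X,B;\mathcal R)=\widehat C^{\mathcal M}_*(X,B;\mathcal R)/C_*(B;\mathcal R),$$ and the *marked homology* $H^{\mathcal M}_*(X,B;\mathcal R)$ is its homology. **Theorem.** Let $(X,B)$ be a marked space and let $\mathcal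 R$ be a ring with unity. For every $n\in\mathbb N$, the inclusion $i_*\colon C^{\mathcal M}_*(X,B;\mathcal R)\to C_*(X,B;\mathcal R)$ of marked chains into the relative singular chains of the pair $(X,B)$ induces an isomorphism of $\mathcal R$-modules $$H_n(i_*)\colon H^{\mathcal M}_n(X,B;\mathcal R)\to H_n(X,B;\mathcal R).$$ -/

import Mathlib

open CategoryTheory Limits Topology

universe u v

namespace MarkedHomology

/-- A topological space `F` is a quasicone with apex `b` if there is a homotopy
`H : F × [0,1] → F` from the identity to the constant map at `b` such that
`H⁻¹({b}) = ({b} × [0,1]) ∪ (F × {1})`. -/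
def IsQuasicone {F : Type u} [TopologicalSpace F] (b : F) : Prop :=
  ∃ H : C(F × unitInterval, F),
    (∀ x, H (x, 0) = x) ∧ (∀ x, H (x, 1) = b) ∧
      H ⁻¹' {b} = ({b} ×ˢ Set.univ) ∪ (Set.univ ×ˢ {1})

/-- The pair `(X, B)` is a marked space: `B` is closed in `X` and the points of `B` have pairwise
disjoint closed neighbourhoods `F b` in `X`, such that `F b`, with the subspace topology,
is a quasicone with apex `b`. -/
structure IsMarkedSpace {X : Type u} [TopologicalSpace X] (B : Set X) : Prop where
  isClosed : IsClosed B
  exists_nhds : ∃ F : B → Set X,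
    (∀ b : B, IsClosed (F b) ∧ F b ∈ 𝓝 (b : X) ∧
      ∃ hb : (b : X) ∈ F b, IsQuasicone (⟨b, hb⟩ : F b)) ∧
    Pairwise fun b b' => Disjoint (F b) (F b')

/-- The closed face of the standard simplex with vertex set `I`
(it is the whole simplex if `I` is everything, and it is empty if `I` is empty). -/
def face {n : ℕ} (I : Set (Fin (n + 1))) : Set (stdSimplex ℝ (Fin (n + 1))) :=
  {p | ∀ i, i ∉ I → p i = 0}

/-- A singular simplex `σ : Δⁿ → X` is admissible with respect to `B ⊆ X` if `σ⁻¹(B)` is a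
subcomplex of `Δⁿ`, i.e. a (possibly empty) union of (not necessarily proper) faces of `Δⁿ`. -/
def IsAdmissible {X : Type u} [TopologicalSpace X] (B : Set X) {n : ℕ}
    (σ : C(stdSimplex ℝ (Fin (n + 1)), X)) : Prop :=
  ∃ 𝓕 : Set (Set (Fin (n + 1))), σ ⁻¹' B = ⋃ I ∈ 𝓕, face I

lemma preimage_face {m n : ℕ} (f : Fin (m + 1) → Fin (n + 1)) (I : Set (Fin (n + 1))) :
    stdSimplex.map (S := ℝ) f ⁻¹' face I = face (f ⁻¹' I) := by
  ext p
  simp only [face, Set.mem_preimage, Set.mem_ofPred_eq, stdSimplex.map_coe,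
    FunOnFinite.linearMap_apply_apply]
  constructor
  · intro h i hi
    have h1 := h (f i) hi
    rw [Finset.sum_eq_zero_iff_of_nonneg (fun j _ => stdSimplex.zero_le p j)] at h1
    exact h1 i (by simp)
  · intro h j hj
    refine Finset.sum_eq_zero fun i hi => h i ?_
    simp only [Finset.mem_filter, Finset.mem_univ, true_and] at hi
    simpa [hi] using hj

lemma IsAdmissible.comp_map {X : Type u} [TopologicalSpace X] {B : Set X} {m n : ℕ}
    {σ : C(stdSimplex ℝ (Fin (n + 1)), X)} (hσ : IsAdmissible B σ)
    {τ : C(stdSimplex ℝ (Fin (m + 1)), X)} (f : Fin (m + 1) → Fin (n + 1))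
    (hτ : ∀ p, τ p = σ (stdSimplex.map f p)) : IsAdmissible B τ := by
  obtain ⟨𝓕, h⟩ := hσ
  refine ⟨(fun I => f ⁻¹' I) '' 𝓕, ?_⟩
  have : τ ⁻¹' B = stdSimplex.map f ⁻¹' (σ ⁻¹' B) := by
    ext p
    simp [hτ]
  rw [this, h, Set.preimage_iUnion₂, Set.biUnion_image]
  simp only [preimage_face]

lemma toSSetObjEquiv_map (X : TopCat.{u}) {m n : SimplexCategoryᵒᵖ} (g : m ⟶ n)
    (s : (TopCat.toSSet.obj X).obj m) (p : stdSimplex ℝ (Fin (n.unop.len + 1))) :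
    X.toSSetObjEquiv n ((TopCat.toSSet.obj X).map g s) p =
      X.toSSetObjEquiv m s (stdSimplex.map g.unop p) :=
  rfl

/-- The admissible singular simplices of `(X, B)` form a simplicial subset of the singular
simplicial set of `X`. -/
noncomputable def admissibleSubcomplex {X : Type u} [TopologicalSpace X] (B : Set X) :
    (TopCat.toSSet.obj (TopCat.of X)).Subcomplex where
  obj n := {s | IsAdmissible B ((TopCat.of X).toSSetObjEquiv n s)}
  map g _ hs := IsAdmissible.comp_map hs (SimplexCategory.Hom.toOrderHom g.unop)
    (toSSetObjEquiv_map _ g _)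

/-- The map of singular simplicial sets induced by the inclusion of the subspace `B` in `X`. -/
noncomputable def singularInclusion {X : Type u} [TopologicalSpace X] (B : Set X) :
    TopCat.toSSet.obj (TopCat.of B) ⟶ TopCat.toSSet.obj (TopCat.of X) :=
  TopCat.toSSet.map (TopCat.ofHom ⟨Subtype.val, continuous_subtype_val⟩)

lemma range_singularInclusion_le {X : Type u} [TopologicalSpace X] (B : Set X) :
    SSet.Subcomplex.range (singularInclusion B) ≤ admissibleSubcomplex B := by
  rintro n _ ⟨s, rfl⟩
  refine ⟨{Set.univ}, ?_⟩
  have h1 : (⋃ I ∈ ({Set.univ} : Set (Set (Fin (n.unop.len + 1)))), face I) = Set.univ := by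
    simp [face]
  rw [h1]
  exact Set.eq_univ_of_forall fun p => ((TopCat.of B).toSSetObjEquiv n s p).2

/-- The singular simplices of `B`, as admissible singular simplices of `(X, B)`. -/
noncomputable def toAdmissible {X : Type u} [TopologicalSpace X] (B : Set X) :
    TopCat.toSSet.obj (TopCat.of B) ⟶ (admissibleSubcomplex B).toSSet :=
  SSet.Subcomplex.lift (singularInclusion B) (range_singularInclusion_le B)

section Chains

variable (R : Type v) [Ring R] {X : Type u} [TopologicalSpace X] (B : Set X)

/-- The ring `R` as a module over itself, in a universe which is large enough for chains
on a space in `Type u`. -/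
abbrev coeff : ModuleCat.{max u v} R := ModuleCat.of R (ULift.{u} R)

/-- The relative singular chain complex `C_*(X, B; R) = C_*(X; R) / C_*(B; R)`. -/
noncomputable def relativeChainComplex : ChainComplex (ModuleCat.{max u v} R) ℕ :=
  cokernel (SSet.chainComplexMap (singularInclusion B) (coeff.{u, v} R))

/-- The marked chain complex `C^M_*(X, B; R)`: the quotient of the complex of the chains on
admissible singular simplices of `(X, B)` by `C_*(B; R)`. -/
noncomputable def markedChainComplex : ChainComplex (ModuleCat.{max u v} R) ℕ :=
  cokernel (SSet.chainComplexMap (toAdmissible B) (coeff.{u, v} R))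

/-- The chain map `C^M_*(X, B; R) → C_*(X, B; R)` induced on the quotients by the inclusion
of admissible chains into the singular chains of `X`. -/
noncomputable def markedInclusion : markedChainComplex R B ⟶ relativeChainComplex R B :=
  cokernel.map (SSet.chainComplexMap (toAdmissible B) (coeff.{u, v} R))
    (SSet.chainComplexMap (singularInclusion B) (coeff.{u, v} R))
    (𝟙 _) (SSet.chainComplexMap (admissibleSubcomplex B).ι (coeff.{u, v} R))
    (by
      rw [Category.id_comp]
      exact (((SSet.chainComplexFunctor _).obj (coeff.{u, v} R)).map_comp _ _).symm)

/-- Marked homology `H^M_n(X, B; R)`. -/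
noncomputable abbrev markedHomology (n : ℕ) : ModuleCat.{max u v} R :=
  (markedChainComplex R B).homology n

/-- Relative singular homology `H_n(X, B; R)`. -/
noncomputable abbrev relativeHomology (n : ℕ) : ModuleCat.{max u v} R :=
  (relativeChainComplex R B).homology n

/-- The map `H^M_n(X, B; R) → H_n(X, B; R)` induced by the inclusion of marked chains. -/
noncomputable abbrev markedHomologyMap (n : ℕ) :
    markedHomology R B n ⟶ relativeHomology R B n :=
  HomologicalComplex.homologyMap (markedInclusion R B) n

end Chains

end MarkedHomology

/-! By the five lemma for the long exact sequences of the quotients by C_*(B)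
(`quasiIso_cokernel_map`), it suffices that the inclusion of the admissible chains into C_*(X) is a
quasi-isomorphism. In degree 0 every simplex is admissible. In positive degree the point is that a
chain z with admissible boundary is admissible up to a boundary
(`IsMarkedSpace.exists_sub_singularBoundary_mem`).

Barycentric subdivision and its homotopy to the identity preserve admissible chains, because an
admissible simplex stays admissible after composition with any affine map
(`comp_affineMap_mem_admissibleSimplices`). So z may be subdivided until each of its simplices
avoids B, hence is admissible, or lies in a single F_b.

Let z₂ be the non-admissible part of the result; its boundary is still admissible. The quasicone
homotopies yield a cone operator C with ∂Cz₂ = z₂ − C∂z₂. By the condition on H⁻¹({b}), a cone meets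
B only in its apex and along the segments over points already in B, so C preserves admissibility
(`coneSimplex_mem_admissibleSimplices`) and z₂ agrees with the admissible chain C∂z₂ up to a
boundary. -/

namespace MarkedHomology

/-! ### Alternating sums of face maps and the abstract cone formula. -/

section AlternatingSum

variable {α β γ : Type*} {M : Type*} [AddCommGroup M]

/-- The alternating sum of the maps induced on chains by face maps `d i : α → β`. -/
noncomputable def altSum {n : ℕ} (d : Fin n → α → β) : (α →₀ M) →ₗ[ℤ] (β →₀ M) :=
  Finsupp.lsum ℤ fun a => ∑ i : Fin n, (-1 : ℤ) ^ (i : ℕ) • Finsupp.lsingle (d i a)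

lemma altSum_single {n : ℕ} (d : Fin n → α → β) (a : α) (m : M) :
    altSum d (Finsupp.single a m) =
      ∑ i : Fin n, (-1 : ℤ) ^ (i : ℕ) • Finsupp.single (d i a) m := by
  simp [altSum, Finsupp.lsum_single, LinearMap.sum_apply]

lemma altSum_mem_supported {n : ℕ} {d : Fin n → α → β} {s : Set α} {t : Set β}
    (h : ∀ a ∈ s, ∀ i, d i a ∈ t) {c : α →₀ M} (hc : c ∈ Finsupp.supported M ℤ s) :
    altSum d c ∈ Finsupp.supported M ℤ t := by
  rw [← c.sum_single, Finsupp.sum, map_sum]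
  refine Submodule.sum_mem _ fun a ha => ?_
  rw [altSum_single]
  exact Submodule.sum_mem _ fun i _ => Submodule.smul_mem _ _
    (Finsupp.single_mem_supported ℤ _ (h a (hc ha) i))

/-- Face 0 of a cone is its base, and the other faces are cones on the faces of the base with signs
shifted by one. This serves both the straight cones inside a simplex and the cones along a
contraction of F_b. -/
lemma altSum_cone {n : ℕ} {d : Fin (n + 1) → β → α} {d' : Fin n → α → γ} {κ : α → β} {κ' : γ → α}
    {a : α} (h0 : d 0 (κ a) = a) (hs : ∀ i, d i.succ (κ a) = κ' (d' i a)) (m : M) :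
    altSum d (Finsupp.lmapDomain M ℤ κ (Finsupp.single a m)) =
      Finsupp.single a m - Finsupp.lmapDomain M ℤ κ' (altSum d' (Finsupp.single a m)) := by
  rw [Finsupp.lmapDomain_apply, Finsupp.mapDomain_single, altSum_single, altSum_single, map_sum,
    Fin.sum_univ_succ, h0, sub_eq_add_neg, ← Finset.sum_neg_distrib]
  simp [hs, Finsupp.mapDomain_single, pow_succ]

end AlternatingSum

/-! ### Affine simplices in a standard simplex: cones, subdivision, chain homotopy. -/

section Affine

/-- Tuples of `n` points in the standard simplex with `m` vertices. -/
abbrev Tuple (m n : ℕ) : Type := Fin n → stdSimplex ℝ (Fin m)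

variable {k l m n : ℕ}

/-- The affine map which sends the vertices of a simplex to given points of another one. -/
noncomputable def affineMap (w : Tuple m n) : C(stdSimplex ℝ (Fin n), stdSimplex ℝ (Fin m)) where
  toFun p := ⟨∑ j, p j • (w j : Fin m → ℝ),
    (convex_stdSimplex ℝ (Fin m)).sum_mem (fun j _ => p.2.1 j) p.2.2 fun j _ => (w j).2⟩
  continuous_toFun := by
    refine Continuous.subtype_mk (continuous_finsetSum _ fun j _ => ?_) _
    exact ((continuous_apply j).comp continuous_subtype_val).smul continuous_const

lemma affineMap_coe (w : Tuple m n) (p : stdSimplex ℝ (Fin n)) :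
    (affineMap w p : Fin m → ℝ) = ∑ j, p j • (w j : Fin m → ℝ) := rfl

lemma affineMap_apply (w : Tuple m n) (p : stdSimplex ℝ (Fin n)) (i : Fin m) :
    affineMap w p i = ∑ j, p j * w j i := by
  rw [affineMap_coe, Finset.sum_apply]
  rfl

lemma affineMap_comp_affineMap (v : Tuple m l) (w : Tuple l n) :
    affineMap (affineMap v ∘ w) = (affineMap v).comp (affineMap w) := by
  ext p i
  change affineMap _ p i = affineMap v (affineMap w p) i
  simp only [affineMap_apply, Function.comp_apply, Finset.mul_sum, Finset.sum_mul]
  rw [Finset.sum_comm]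
  simp only [mul_assoc]

lemma affineMap_map (w : Tuple m n) (f : Fin k → Fin n) (p : stdSimplex ℝ (Fin k)) :
    affineMap w (stdSimplex.map f p) = affineMap (w ∘ f) p := by
  ext i
  simp only [affineMap_apply, stdSimplex.map_coe, FunOnFinite.linearMap_apply_apply,
    Function.comp_apply, Finset.sum_mul]
  rw [← Finset.sum_fiberwise Finset.univ f]
  refine Finset.sum_congr rfl fun j _ => Finset.sum_congr rfl fun x hx => ?_
  rw [(Finset.mem_filter.1 hx).2]

lemma affineMap_vertex (w : Tuple m n) (j : Fin n) : affineMap w (stdSimplex.vertex j) = w j := by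
  ext i
  rw [affineMap_apply]
  simp [Pi.single_apply]

lemma affineMap_vertices : affineMap (stdSimplex.vertex : Tuple m m) = ContinuousMap.id _ := by
  ext p i
  change affineMap _ p i = p i
  simp [affineMap_apply, Pi.single_apply]

/-- The barycenter of a nonempty tuple of points. -/
noncomputable def tupleBarycenter (w : Tuple m (n + 1)) : stdSimplex ℝ (Fin m) :=
  affineMap w stdSimplex.barycenter

/-- Chains of affine simplices. -/
abbrev AffineChain (m n : ℕ) : Type := Tuple m n →₀ ℤ

/-- The boundary operator on chains of affine simplices. -/
noncomputable def affineBoundary (m n : ℕ) : AffineChain m (n + 1) →ₗ[ℤ] AffineChain m n :=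
  altSum fun i w => w ∘ i.succAbove

/-- The cone operator on chains of affine simplices. -/
noncomputable def affineCone (n : ℕ) (b : stdSimplex ℝ (Fin m)) :
    AffineChain m n →ₗ[ℤ] AffineChain m (n + 1) :=
  Finsupp.lmapDomain ℤ ℤ fun w => (Fin.cons b w : Tuple m (n + 1))

lemma affineCone_single (b : stdSimplex ℝ (Fin m)) (w : Tuple m n) (a : ℤ) :
    affineCone n b (Finsupp.single w a) = Finsupp.single (Fin.cons b w) a :=
  Finsupp.mapDomain_single

/-- Tuples are counted by vertices, so degree 0 holds only the empty tuple: the complex is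
augmented, and the cone formula has no correction term there. -/
lemma affineBoundary_affineCone_zero (b : stdSimplex ℝ (Fin m)) (c : AffineChain m 0) :
    affineBoundary m 0 (affineCone 0 b c) = c := by
  induction c using Finsupp.induction_linear with
  | zero => simp
  | add c c' h h' => rw [map_add, map_add, h, h']
  | single w a =>
    rw [affineCone_single, affineBoundary, altSum_single]
    simp [Subsingleton.elim _ w]

lemma affineBoundary_affineCone (b : stdSimplex ℝ (Fin m)) (c : AffineChain m (n + 1)) :
    affineBoundary m (n + 1) (affineCone (n + 1) b c) = c - affineCone n b (affineBoundary m n c) := by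
  induction c using Finsupp.induction_linear with
  | zero => simp
  | add c c' h h' => simp only [map_add, h, h']; abel
  | single w a =>
    refine altSum_cone (κ := fun w => (Fin.cons b w : Tuple m (n + 2)))
      (κ' := fun w => (Fin.cons b w : Tuple m (n + 1))) ?_ (fun i => ?_) a
    · ext j : 1
      simp
    · ext j : 1
      refine Fin.cases ?_ (fun j => ?_) j <;> simp

lemma single_eq_affineCone (w : Tuple m (n + 1)) (a : ℤ) :
    Finsupp.single w a = affineCone n (w 0) (Finsupp.single (Fin.tail w) a) := by
  rw [affineCone_single, Fin.cons_self_tail]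

/-- Every tuple is the cone from its first vertex on the others, so two uses of the cone formula
reduce the claim to one degree lower, with no double sum of signs. -/
lemma affineBoundary_affineBoundary (c : AffineChain m (n + 2)) :
    affineBoundary m n (affineBoundary m (n + 1) c) = 0 := by
  induction n with
  | zero =>
    induction c using Finsupp.induction_linear with
    | zero => simp
    | add c c' h h' => rw [map_add, map_add, h, h', add_zero]
    | single w a =>
      rw [single_eq_affineCone, affineBoundary_affineCone, map_sub,
        affineBoundary_affineCone_zero, sub_self]
  | succ n ih =>
    induction c using Finsupp.induction_linear with
    | zero => simp
    | add c c' h h' => rw [map_add, map_add, h, h', add_zero]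
    | single w a =>
      rw [single_eq_affineCone, affineBoundary_affineCone, map_sub,
        affineBoundary_affineCone, ih, map_zero, sub_zero, sub_self]

/-- The barycentric subdivision of chains of affine simplices. -/
noncomputable def affineSubdivision (m : ℕ) : (n : ℕ) → AffineChain m n →ₗ[ℤ] AffineChain m n
  | 0 => LinearMap.id
  | n + 1 => Finsupp.linearCombination ℤ fun w => affineCone n (tupleBarycenter w)
      (affineSubdivision m n (affineBoundary m n (Finsupp.single w 1)))

/-- The chain homotopy from the identity to the barycentric subdivision. -/
noncomputable def affineHomotopy (m : ℕ) : (n : ℕ) → AffineChain m n →ₗ[ℤ] AffineChain m (n + 1)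
  | 0 => 0
  | n + 1 => Finsupp.linearCombination ℤ fun w => affineCone (n + 1) (tupleBarycenter w)
      (Finsupp.single w 1 - affineHomotopy m n (affineBoundary m n (Finsupp.single w 1)))

lemma affineSubdivision_single (w : Tuple m (n + 1)) :
    affineSubdivision m (n + 1) (Finsupp.single w 1) = affineCone n (tupleBarycenter w)
      (affineSubdivision m n (affineBoundary m n (Finsupp.single w 1))) := by
  rw [affineSubdivision, Finsupp.linearCombination_single, one_smul]

lemma affineHomotopy_single (w : Tuple m (n + 1)) :
    affineHomotopy m (n + 1) (Finsupp.single w 1) = affineCone (n + 1) (tupleBarycenter w)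
      (Finsupp.single w 1 - affineHomotopy m n (affineBoundary m n (Finsupp.single w 1))) := by
  rw [affineHomotopy, Finsupp.linearCombination_single, one_smul]

lemma affineChain_ext {N : Type*} [AddCommGroup N] {f g : AffineChain m n →ₗ[ℤ] N}
    (h : ∀ w, f (Finsupp.single w 1) = g (Finsupp.single w 1)) : f = g :=
  Finsupp.lhom_ext' fun w => LinearMap.ext_ring (h w)

lemma affineBoundary_comp_affineSubdivision (m n : ℕ) :
    affineBoundary m n ∘ₗ affineSubdivision m (n + 1) =
      affineSubdivision m n ∘ₗ affineBoundary m n := by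
  induction n with
  | zero =>
    refine affineChain_ext fun w => ?_
    rw [LinearMap.comp_apply, affineSubdivision_single, affineBoundary_affineCone_zero]
    rfl
  | succ n ih =>
    refine affineChain_ext fun w => ?_
    rw [LinearMap.comp_apply, affineSubdivision_single, affineBoundary_affineCone,
      ← LinearMap.comp_apply (affineBoundary m n), ih, LinearMap.comp_apply,
      affineBoundary_affineBoundary, map_zero, map_zero, sub_zero]
    rfl

lemma affineBoundary_affineHomotopy (c : AffineChain m (n + 1)) :
    affineBoundary m (n + 1) (affineHomotopy m (n + 1) c) =
      c - affineSubdivision m (n + 1) c - affineHomotopy m n (affineBoundary m n c) := by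
  suffices affineBoundary m (n + 1) ∘ₗ affineHomotopy m (n + 1) =
      LinearMap.id - affineSubdivision m (n + 1) - affineHomotopy m n ∘ₗ affineBoundary m n from
    LinearMap.congr_fun this c
  clear c
  induction n with
  | zero =>
    refine affineChain_ext fun w => ?_
    rw [LinearMap.comp_apply, affineHomotopy_single, affineBoundary_affineCone]
    simp only [LinearMap.sub_apply, LinearMap.id_apply, LinearMap.comp_apply,
      affineSubdivision_single, affineHomotopy, LinearMap.zero_apply, sub_zero]
    rfl
  | succ n ih =>
    refine affineChain_ext fun w => ?_
    -- With S the subdivision and T the homotopy, this gives ∂T∂w = ∂w − S∂w. Hence the boundary of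
    -- w − T∂w is S∂w, and its cone from the barycenter is Sw.
    have h := LinearMap.congr_fun ih (affineBoundary m (n + 1) (Finsupp.single w 1))
    simp only [LinearMap.sub_apply, LinearMap.id_apply, LinearMap.comp_apply,
      affineBoundary_affineBoundary, map_zero, sub_zero] at h
    rw [LinearMap.comp_apply, affineHomotopy_single, affineBoundary_affineCone, map_sub, h,
      sub_sub_cancel]
    simp only [LinearMap.sub_apply, LinearMap.id_apply, LinearMap.comp_apply,
      affineSubdivision_single]
    abel

/-- The map on chains of affine simplices induced by an affine map. -/
noncomputable def affinePush (n : ℕ) (v : Tuple m l) : AffineChain l n →ₗ[ℤ] AffineChain m n :=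
  Finsupp.lmapDomain ℤ ℤ fun w => affineMap v ∘ w

lemma affinePush_single (v : Tuple m l) (w : Tuple l n) (a : ℤ) :
    affinePush n v (Finsupp.single w a) = Finsupp.single (affineMap v ∘ w) a :=
  Finsupp.mapDomain_single

lemma affinePush_affineBoundary (v : Tuple m l) (c : AffineChain l (n + 1)) :
    affinePush n v (affineBoundary l n c) = affineBoundary m n (affinePush (n + 1) v c) := by
  suffices affinePush n v ∘ₗ affineBoundary l n = affineBoundary m n ∘ₗ affinePush (n + 1) v from
    LinearMap.congr_fun this c
  refine affineChain_ext fun w => ?_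
  simp only [LinearMap.comp_apply, affinePush_single, affineBoundary, altSum_single, map_sum,
    map_smul, Function.comp_assoc]

lemma affinePush_affineCone (v : Tuple m l) (b : stdSimplex ℝ (Fin l)) (c : AffineChain l n) :
    affinePush (n + 1) v (affineCone n b c) = affineCone n (affineMap v b) (affinePush n v c) := by
  suffices affinePush (n + 1) v ∘ₗ affineCone n b =
      affineCone n (affineMap v b) ∘ₗ affinePush n v from LinearMap.congr_fun this c
  refine affineChain_ext fun w => ?_
  simp only [LinearMap.comp_apply, affinePush_single, affineCone_single]
  congr 1
  ext j : 1
  refine Fin.cases ?_ (fun j => ?_) j <;> simp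

lemma tupleBarycenter_affineMap (v : Tuple m l) (w : Tuple l (n + 1)) :
    tupleBarycenter (affineMap v ∘ w) = affineMap v (tupleBarycenter w) := by
  rw [tupleBarycenter, affineMap_comp_affineMap]
  rfl

/-- Affine maps commute with cones, boundaries and barycenters, the only ingredients of the
recursion. -/
lemma affinePush_affineSubdivision (v : Tuple m l) (c : AffineChain l n) :
    affinePush n v (affineSubdivision l n c) = affineSubdivision m n (affinePush n v c) := by
  suffices affinePush n v ∘ₗ affineSubdivision l n =
      affineSubdivision m n ∘ₗ affinePush n v from LinearMap.congr_fun this c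
  clear c
  induction n with
  | zero => rfl
  | succ n ih =>
    refine affineChain_ext fun w => ?_
    simp only [LinearMap.comp_apply, affinePush_single, affineSubdivision_single,
      affinePush_affineCone, tupleBarycenter_affineMap]
    rw [← LinearMap.comp_apply (affinePush n v), ih, LinearMap.comp_apply,
      affinePush_affineBoundary, affinePush_single]

lemma affinePush_affineHomotopy (v : Tuple m l) (c : AffineChain l n) :
    affinePush (n + 1) v (affineHomotopy l n c) = affineHomotopy m n (affinePush n v c) := by
  suffices affinePush (n + 1) v ∘ₗ affineHomotopy l n =
      affineHomotopy m n ∘ₗ affinePush n v from LinearMap.congr_fun this c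
  clear c
  induction n with
  | zero => simp [affineHomotopy]
  | succ n ih =>
    refine affineChain_ext fun w => ?_
    simp only [LinearMap.comp_apply, affinePush_single, affineHomotopy_single, map_sub,
      affinePush_affineCone, tupleBarycenter_affineMap]
    rw [← LinearMap.comp_apply (affinePush (n + 1) v), ih, LinearMap.comp_apply,
      affinePush_affineBoundary, affinePush_single]

end Affine

/-! ### The diameter of the pieces of a barycentric subdivision. -/

section Mesh

variable {m n : ℕ}

lemma affineMap_mem_of_convex {K : Set (Fin m → ℝ)} (hK : Convex ℝ K) {w : Tuple m n}
    (hw : ∀ j, (w j : Fin m → ℝ) ∈ K) (p : stdSimplex ℝ (Fin n)) :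
    (affineMap w p : Fin m → ℝ) ∈ K :=
  hK.sum_mem (fun j _ => p.2.1 j) p.2.2 fun j _ => hw j

lemma mem_support_affineCone {b : stdSimplex ℝ (Fin m)} {c : AffineChain m n}
    {u : Tuple m (n + 1)} (hu : u ∈ (affineCone n b c).support) :
    ∃ w ∈ c.support, u = Fin.cons b w := by
  classical
  obtain ⟨w, hw, rfl⟩ := Finset.mem_image.1 (Finsupp.mapDomain_support hu)
  exact ⟨w, hw, rfl⟩

lemma mem_support_affineSubdivision {w : Tuple m (n + 1)} {u : Tuple m (n + 1)}
    (hu : u ∈ (affineSubdivision m (n + 1) (Finsupp.single w 1)).support) :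
    ∃ (i : Fin (n + 1)), ∃ u' ∈ (affineSubdivision m n
      (Finsupp.single (w ∘ i.succAbove) 1)).support, u = Fin.cons (tupleBarycenter w) u' := by
  classical
  rw [affineSubdivision_single] at hu
  obtain ⟨u', hu', rfl⟩ := mem_support_affineCone hu
  rw [affineBoundary, altSum_single, map_sum] at hu'
  obtain ⟨i, -, hi⟩ := Finset.mem_biUnion.1 (Finsupp.support_finsetSum hu')
  rw [map_smul] at hi
  exact ⟨i, u', Finsupp.support_smul hi, rfl⟩

lemma affineSubdivision_mem_of_convex {K : Set (Fin m → ℝ)} (hK : Convex ℝ K) {w : Tuple m n}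
    (hw : ∀ j, (w j : Fin m → ℝ) ∈ K) {u : Tuple m n}
    (hu : u ∈ (affineSubdivision m n (Finsupp.single w 1)).support) (j : Fin n) :
    (u j : Fin m → ℝ) ∈ K := by
  induction n with
  | zero => exact j.elim0
  | succ n ih =>
    obtain ⟨i, u', hu', rfl⟩ := mem_support_affineSubdivision hu
    refine Fin.cases ?_ (fun j => ?_) j
    · exact affineMap_mem_of_convex hK hw _
    · exact ih (fun j => hw _) hu' j

/-- The difference is the average of the n + 1 vectors w j − w i, one of which vanishes. The uniform
`N` gives a single ratio for all faces in the induction of `dist_affineSubdivision_le`. -/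
lemma dist_tupleBarycenter_le {N : ℕ} (hn : n ≤ N) {δ : ℝ} (hδ : 0 ≤ δ) {w : Tuple m (n + 1)}
    (hw : ∀ i j, dist (w i) (w j) ≤ δ) (j : Fin (n + 1)) :
    dist (w j) (tupleBarycenter w) ≤ N / (N + 1) * δ := by
  have hpos : (0 : ℝ) < n + 1 := by positivity
  have h1 : (w j : Fin m → ℝ) - tupleBarycenter w =
      ((n : ℝ) + 1)⁻¹ • ∑ i, ((w j : Fin m → ℝ) - w i) := by
    rw [tupleBarycenter, affineMap_coe, Finset.sum_sub_distrib, smul_sub, Finset.smul_sum,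
      Finset.smul_sum]
    congr 1
    · rw [← Finset.smul_sum, Finset.sum_const, Finset.card_univ, Fintype.card_fin,
        ← Nat.cast_smul_eq_nsmul ℝ, smul_smul]
      push_cast
      rw [inv_mul_cancel₀ hpos.ne', one_smul]
    · refine Finset.sum_congr rfl fun i _ => ?_
      congr 1
      change (Fintype.card (Fin (n + 1)) : ℝ)⁻¹ = _
      simp
  have h2 : ∑ i, ‖(w j : Fin m → ℝ) - w i‖ ≤ n * δ := by
    rw [← Finset.add_sum_erase _ _ (Finset.mem_univ j), sub_self, norm_zero, zero_add]
    refine (Finset.sum_le_card_nsmul _ _ δ fun i _ => ?_).trans ?_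
    · rw [← dist_eq_norm]
      exact hw j i
    · simp [Finset.card_erase_of_mem]
  change dist (w j : Fin m → ℝ) (tupleBarycenter w : Fin m → ℝ) ≤ _
  rw [dist_eq_norm, h1, norm_smul, norm_inv, Real.norm_of_nonneg hpos.le]
  calc ((n : ℝ) + 1)⁻¹ * ‖∑ i, ((w j : Fin m → ℝ) - w i)‖ ≤ ((n : ℝ) + 1)⁻¹ * (n * δ) := by
        gcongr
        exact (norm_sum_le _ _).trans h2
    _ = n / (n + 1) * δ := by ring
    _ ≤ N / (N + 1) * δ := by
        refine mul_le_mul_of_nonneg_right ?_ hδ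
        have : (n : ℝ) ≤ N := by exact_mod_cast hn
        rw [div_le_div_iff₀ hpos (by positivity)]
        linarith

/-- A piece consists of the barycenter and a piece of a facet. Distances to the barycenter are
bounded because balls are convex; the others by induction. -/
lemma dist_affineSubdivision_le {N : ℕ} (hn : n ≤ N + 1) {δ : ℝ} (hδ : 0 ≤ δ) {w : Tuple m n}
    (hw : ∀ i j, dist (w i) (w j) ≤ δ) {u : Tuple m n}
    (hu : u ∈ (affineSubdivision m n (Finsupp.single w 1)).support) (i j : Fin n) :
    dist (u i) (u j) ≤ N / (N + 1) * δ := by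
  induction n with
  | zero => exact i.elim0
  | succ n ih =>
    have hball : ∀ j, (w j : Fin m → ℝ) ∈
        Metric.closedBall (tupleBarycenter w : Fin m → ℝ) (N / (N + 1) * δ) := fun j =>
      dist_tupleBarycenter_le (by omega) hδ hw j
    have hnn : 0 ≤ N / (N + 1) * δ := by positivity
    obtain ⟨r, u', hu', rfl⟩ := mem_support_affineSubdivision hu
    have hb : ∀ j, dist (u' j) (tupleBarycenter w) ≤ N / (N + 1) * δ := fun j =>
      affineSubdivision_mem_of_convex (convex_closedBall _ _) (fun j => hball _) hu' j
    refine Fin.cases ?_ (fun i => ?_) i <;> refine Fin.cases ?_ (fun j => ?_) j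
    · simpa using hnn
    · simpa [dist_comm] using hb j
    · simpa using hb i
    · exact ih (by omega) (fun i j => hw _ _) hu' i j

end Mesh

/-! ### Subdivision of singular chains, with coefficients in an abelian group. -/

section SingularChains

/-- Singular simplices with `n` vertices (there is a unique one for `n = 0`). -/
abbrev SingularSimplex (X : Type*) [TopologicalSpace X] (n : ℕ) : Type _ :=
  C(stdSimplex ℝ (Fin n), X)

variable {X : Type*} [TopologicalSpace X] {M : Type*} [AddCommGroup M] {k m n : ℕ}

/-- The simplex obtained by reindexing the vertices. -/
noncomputable def SingularSimplex.reindex (σ : SingularSimplex X n) (f : Fin m → Fin n) :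
    SingularSimplex X m :=
  σ.comp ⟨stdSimplex.map f, stdSimplex.continuous_map f⟩

lemma SingularSimplex.reindex_apply (σ : SingularSimplex X n) (f : Fin m → Fin n)
    (p : stdSimplex ℝ (Fin m)) : σ.reindex f p = σ (stdSimplex.map f p) := rfl

/-- The boundary operator on singular chains. -/
noncomputable def singularBoundary (X : Type*) [TopologicalSpace X] (M : Type*) [AddCommGroup M]
    (n : ℕ) : (SingularSimplex X (n + 1) →₀ M) →ₗ[ℤ] (SingularSimplex X n →₀ M) :=
  altSum fun i σ => σ.reindex i.succAbove

lemma reindex_comp_affineMap (σ : SingularSimplex X k) (w : Tuple k n) (f : Fin m → Fin n) :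
    SingularSimplex.reindex (σ.comp (affineMap w)) f = σ.comp (affineMap (w ∘ f)) := by
  ext p
  exact congrArg σ (affineMap_map w f p)

lemma comp_affineMap_vertices (σ : SingularSimplex X n) :
    σ.comp (affineMap (stdSimplex.vertex : Tuple n n)) = σ := by
  rw [affineMap_vertices, ContinuousMap.comp_id]

/-- The action of chains of affine simplices in the source of a singular simplex. -/
noncomputable def affineAction (M : Type*) [AddCommGroup M] (σ : SingularSimplex X k) (n : ℕ) :
    AffineChain k n →ₗ[ℤ] (M →ₗ[ℤ] (SingularSimplex X n →₀ M)) :=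
  Finsupp.linearCombination ℤ fun w =>
    (Finsupp.lsingle (σ.comp (affineMap w)) : M →ₗ[ℤ] (SingularSimplex X n →₀ M))

lemma affineAction_single (σ : SingularSimplex X k) (w : Tuple k n) (a : M) :
    affineAction M σ n (Finsupp.single w 1) a = Finsupp.single (σ.comp (affineMap w)) a := by
  rw [affineAction, Finsupp.linearCombination_single, one_smul, Finsupp.lsingle_apply]

lemma affineAction_vertices (σ : SingularSimplex X n) (a : M) :
    affineAction M σ n (Finsupp.single stdSimplex.vertex 1) a = Finsupp.single σ a := by
  rw [affineAction_single, comp_affineMap_vertices]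

lemma singularBoundary_affineAction (σ : SingularSimplex X k) (c : AffineChain k (n + 1)) (a : M) :
    singularBoundary X M n (affineAction M σ (n + 1) c a) =
      affineAction M σ n (affineBoundary k n c) a := by
  suffices singularBoundary X M n ∘ₗ (affineAction M σ (n + 1)).flip a =
      (affineAction M σ n).flip a ∘ₗ affineBoundary k n from LinearMap.congr_fun this c
  refine affineChain_ext fun w => ?_
  simp only [LinearMap.comp_apply, LinearMap.flip_apply, affineAction_single, affineBoundary,
    singularBoundary, altSum_single, map_sum, map_smul,
    reindex_comp_affineMap]

lemma affineAction_comp_affineMap (σ : SingularSimplex X k) (v : Tuple k m) (c : AffineChain m n)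
    (a : M) :
    affineAction M (σ.comp (affineMap v)) n c a = affineAction M σ n (affinePush n v c) a := by
  suffices (affineAction M (σ.comp (affineMap v)) n).flip a =
      (affineAction M σ n).flip a ∘ₗ affinePush n v from LinearMap.congr_fun this c
  refine affineChain_ext fun w => ?_
  simp only [LinearMap.comp_apply, LinearMap.flip_apply, affineAction_single, affinePush_single,
    affineMap_comp_affineMap, ContinuousMap.comp_assoc]

lemma mem_support_affineAction {σ : SingularSimplex X k} {c : AffineChain k n} {a : M}
    {τ : SingularSimplex X n} (h : τ ∈ (affineAction M σ n c a).support) :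
    ∃ w ∈ c.support, τ = σ.comp (affineMap w) := by
  classical
  rw [affineAction, Finsupp.linearCombination_apply, Finsupp.sum, LinearMap.sum_apply] at h
  obtain ⟨w, hw, h⟩ := Finset.mem_biUnion.1 (Finsupp.support_finsetSum h)
  rw [LinearMap.smul_apply] at h
  exact ⟨w, hw, by simpa using Finsupp.support_single_subset (Finsupp.support_smul h)⟩

/-- The barycentric subdivision of singular chains. -/
noncomputable def subdivision (X : Type*) [TopologicalSpace X] (M : Type*) [AddCommGroup M]
    (n : ℕ) : (SingularSimplex X n →₀ M) →ₗ[ℤ] (SingularSimplex X n →₀ M) :=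
  Finsupp.lsum ℤ fun σ =>
    affineAction M σ n (affineSubdivision n n (Finsupp.single stdSimplex.vertex 1))

/-- The chain homotopy from the identity to the barycentric subdivision. -/
noncomputable def subdivisionHomotopy (X : Type*) [TopologicalSpace X] (M : Type*)
    [AddCommGroup M] (n : ℕ) : (SingularSimplex X n →₀ M) →ₗ[ℤ] (SingularSimplex X (n + 1) →₀ M) :=
  Finsupp.lsum ℤ fun σ =>
    affineAction M σ (n + 1) (affineHomotopy n n (Finsupp.single stdSimplex.vertex 1))

lemma subdivision_single (σ : SingularSimplex X n) (a : M) :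
    subdivision X M n (Finsupp.single σ a) =
      affineAction M σ n (affineSubdivision n n (Finsupp.single stdSimplex.vertex 1)) a :=
  Finsupp.lsum_single _ _ _ _

lemma subdivision_apply (z : SingularSimplex X n →₀ M) :
    subdivision X M n z = z.sum fun σ a =>
      affineAction M σ n (affineSubdivision n n (Finsupp.single stdSimplex.vertex 1)) a :=
  rfl

lemma subdivisionHomotopy_single (σ : SingularSimplex X n) (a : M) :
    subdivisionHomotopy X M n (Finsupp.single σ a) =
      affineAction M σ (n + 1) (affineHomotopy n n (Finsupp.single stdSimplex.vertex 1)) a :=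
  Finsupp.lsum_single _ _ _ _

lemma affinePush_vertices (w : Tuple k n) :
    affinePush n w (Finsupp.single stdSimplex.vertex 1) = Finsupp.single w 1 := by
  rw [affinePush_single]
  congr 1
  ext j : 1
  exact affineMap_vertex w j

/-- The subdivision of σ is defined by a universal affine chain; naturality under `affinePush`
carries it to any affine simplex in the source of σ. Identities for singular chains thus reduce to
affine ones. -/
lemma subdivision_affineAction (σ : SingularSimplex X k) (c : AffineChain k n) (a : M) :
    subdivision X M n (affineAction M σ n c a) =
      affineAction M σ n (affineSubdivision k n c) a := by
  suffices subdivision X M n ∘ₗ (affineAction M σ n).flip a =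
      (affineAction M σ n).flip a ∘ₗ affineSubdivision k n from LinearMap.congr_fun this c
  refine affineChain_ext fun w => ?_
  simp only [LinearMap.comp_apply, LinearMap.flip_apply, affineAction_single, subdivision_single,
    affineAction_comp_affineMap, affinePush_affineSubdivision, affinePush_vertices]

lemma subdivisionHomotopy_affineAction (σ : SingularSimplex X k) (c : AffineChain k n) (a : M) :
    subdivisionHomotopy X M n (affineAction M σ n c a) =
      affineAction M σ (n + 1) (affineHomotopy k n c) a := by
  suffices subdivisionHomotopy X M n ∘ₗ (affineAction M σ n).flip a =
      (affineAction M σ (n + 1)).flip a ∘ₗ affineHomotopy k n from LinearMap.congr_fun this c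
  refine affineChain_ext fun w => ?_
  simp only [LinearMap.comp_apply, LinearMap.flip_apply, affineAction_single,
    subdivisionHomotopy_single, affineAction_comp_affineMap, affinePush_affineHomotopy,
    affinePush_vertices]

lemma singularBoundary_subdivision (z : SingularSimplex X (n + 1) →₀ M) :
    singularBoundary X M n (subdivision X M (n + 1) z) =
      subdivision X M n (singularBoundary X M n z) := by
  induction z using Finsupp.induction_linear with
  | zero => simp
  | add c c' h h' => simp only [map_add, h, h']
  | single σ a =>
    have h := LinearMap.congr_fun (affineBoundary_comp_affineSubdivision (n + 1) n)
      (Finsupp.single stdSimplex.vertex 1)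
    -- σ is the image of the identity simplex, so only affine chains remain to be compared.
    rw [← affineAction_vertices σ a, subdivision_affineAction, singularBoundary_affineAction,
      singularBoundary_affineAction, subdivision_affineAction]
    simp only [LinearMap.comp_apply] at h
    rw [h]

lemma singularBoundary_subdivisionHomotopy (z : SingularSimplex X (n + 1) →₀ M) :
    singularBoundary X M (n + 1) (subdivisionHomotopy X M (n + 1) z) =
      z - subdivision X M (n + 1) z - subdivisionHomotopy X M n (singularBoundary X M n z) := by
  induction z using Finsupp.induction_linear with
  | zero => simp
  | add c c' h h' => simp only [map_add, h, h']; abel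
  | single σ a =>
    rw [← affineAction_vertices σ a, subdivision_affineAction, subdivisionHomotopy_affineAction,
      singularBoundary_affineAction, singularBoundary_affineAction,
      subdivisionHomotopy_affineAction, affineBoundary_affineHomotopy]
    simp only [map_sub, LinearMap.sub_apply]

end SingularChains

/-! ### Admissible simplices and their stability under subdivision. -/

section Admissible

variable {X : Type*} [TopologicalSpace X] {M : Type*} [AddCommGroup M] {B : Set X} {k m n : ℕ}

/-- The admissible singular simplices with `n` vertices. -/
def admissibleSimplices (B : Set X) (n : ℕ) : Set (SingularSimplex X n) :=
  {σ | ∃ 𝓕 : Set (Set (Fin n)), σ ⁻¹' B = ⋃ I ∈ 𝓕, {p | ∀ i, i ∉ I → p i = 0}}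

/-- The preimage of a face under an affine map is the face spanned by the vertices sent into it: a
sum of nonnegative terms p j * w j i vanishes only if each term does. -/
lemma comp_affineMap_mem_admissibleSimplices {σ : SingularSimplex X k}
    (hσ : σ ∈ admissibleSimplices B k) (w : Tuple k n) :
    σ.comp (affineMap w) ∈ admissibleSimplices B n := by
  obtain ⟨𝓕, h⟩ := hσ
  refine ⟨(fun I => {j | ∀ i, i ∉ I → w j i = 0}) '' 𝓕, ?_⟩
  rw [ContinuousMap.coe_comp, Set.preimage_comp, h, Set.preimage_iUnion₂, Set.biUnion_image]
  refine Set.iUnion₂_congr fun I _ => ?_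
  ext p
  simp only [Set.mem_preimage, Set.mem_ofPred_eq, affineMap_apply]
  constructor
  · intro hp j hj
    push Not at hj
    obtain ⟨i, hi, hji⟩ := hj
    have := (Finset.sum_eq_zero_iff_of_nonneg fun j _ =>
      mul_nonneg (p.2.1 j) ((w j).2.1 i)).1 (hp i hi) j (Finset.mem_univ _)
    exact (mul_eq_zero.1 this).resolve_right hji
  · intro hp i hi
    refine Finset.sum_eq_zero fun j _ => ?_
    by_cases hj : ∀ i, i ∉ I → w j i = 0
    · rw [hj i hi, mul_zero]
    · rw [hp j hj, zero_mul]

lemma reindex_mem_admissibleSimplices {σ : SingularSimplex X n}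
    (hσ : σ ∈ admissibleSimplices B n) (f : Fin m → Fin n) :
    σ.reindex f ∈ admissibleSimplices B m := by
  rw [← comp_affineMap_vertices σ, reindex_comp_affineMap]
  exact comp_affineMap_mem_admissibleSimplices hσ _

lemma mem_admissibleSimplices_of_disjoint {σ : SingularSimplex X n} (hσ : ∀ p, σ p ∉ B) :
    σ ∈ admissibleSimplices B n :=
  ⟨∅, by simpa [Set.eq_empty_iff_forall_notMem] using hσ⟩

lemma mem_admissibleSimplices_one (σ : SingularSimplex X 1) : σ ∈ admissibleSimplices B 1 := by
  by_cases h : ∃ p, σ p ∈ B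
  · obtain ⟨p, hp⟩ := h
    refine ⟨{Set.univ}, ?_⟩
    ext q
    simpa [Subsingleton.elim q p] using hp
  · exact mem_admissibleSimplices_of_disjoint (by simpa using h)

lemma singularBoundary_mem_admissible {z : SingularSimplex X (n + 1) →₀ M}
    (hz : z ∈ Finsupp.supported M ℤ (admissibleSimplices B (n + 1))) :
    singularBoundary X M n z ∈ Finsupp.supported M ℤ (admissibleSimplices B n) :=
  altSum_mem_supported (fun _ ha i => reindex_mem_admissibleSimplices ha i.succAbove) hz

lemma affineAction_mem_admissible {σ : SingularSimplex X k} (hσ : σ ∈ admissibleSimplices B k)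
    (c : AffineChain k n) (a : M) :
    affineAction M σ n c a ∈ Finsupp.supported M ℤ (admissibleSimplices B n) := by
  intro τ hτ
  obtain ⟨w, -, rfl⟩ := mem_support_affineAction hτ
  exact comp_affineMap_mem_admissibleSimplices hσ w

lemma subdivision_mem_admissible {z : SingularSimplex X n →₀ M}
    (hz : z ∈ Finsupp.supported M ℤ (admissibleSimplices B n)) :
    subdivision X M n z ∈ Finsupp.supported M ℤ (admissibleSimplices B n) := by
  rw [subdivision_apply]
  exact Submodule.sum_mem _ fun σ hσ => affineAction_mem_admissible (hz hσ) _ _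

lemma subdivisionHomotopy_mem_admissible {z : SingularSimplex X n →₀ M}
    (hz : z ∈ Finsupp.supported M ℤ (admissibleSimplices B n)) :
    subdivisionHomotopy X M n z ∈ Finsupp.supported M ℤ (admissibleSimplices B (n + 1)) := by
  rw [subdivisionHomotopy, Finsupp.lsum_apply]
  exact Submodule.sum_mem _ fun σ hσ => affineAction_mem_admissible (hz hσ) _ _

lemma exists_sub_singularBoundary_of_iterate {z : SingularSimplex X (n + 1) →₀ M}
    (hz : singularBoundary X M n z ∈ Finsupp.supported M ℤ (admissibleSimplices B n)) (r : ℕ) :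
    singularBoundary X M n ((subdivision X M (n + 1))^[r] z) ∈
        Finsupp.supported M ℤ (admissibleSimplices B n) ∧
      ∃ w, z - (subdivision X M (n + 1))^[r] z - singularBoundary X M (n + 1) w ∈
        Finsupp.supported M ℤ (admissibleSimplices B (n + 1)) := by
  induction r with
  | zero => exact ⟨hz, 0, by simp⟩
  | succ r ih =>
    obtain ⟨h1, w, h2⟩ := ih
    rw [Function.iterate_succ_apply']
    set y := (subdivision X M (n + 1))^[r] z
    refine ⟨?_, w + subdivisionHomotopy X M (n + 1) y, ?_⟩
    · rw [singularBoundary_subdivision]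
      exact subdivision_mem_admissible h1
    · rw [map_add, singularBoundary_subdivisionHomotopy]
      -- The new error term is the homotopy applied to ∂y, which is admissible because ∂y is.
      convert Submodule.add_mem _ h2 (subdivisionHomotopy_mem_admissible h1) using 1
      abel

end Admissible

/-! ### Subdivision until simplices are small with respect to an open cover. -/

section Small

variable {X : Type*} [TopologicalSpace X] {M : Type*} [AddCommGroup M] {n : ℕ}

lemma mem_support_iterate_subdivision (z : SingularSimplex X (n + 1) →₀ M) (r : ℕ)
    {τ : SingularSimplex X (n + 1)} (hτ : τ ∈ ((subdivision X M (n + 1))^[r] z).support) :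
    ∃ σ ∈ z.support, ∃ w : Tuple (n + 1) (n + 1), τ = σ.comp (affineMap w) ∧
      ∀ i j, dist (w i) (w j) ≤ ((n : ℝ) / (n + 1)) ^ r := by
  induction r generalizing τ with
  | zero =>
    refine ⟨τ, hτ, stdSimplex.vertex, (comp_affineMap_vertices τ).symm, fun i j => ?_⟩
    rw [pow_zero]
    exact (Metric.dist_le_diam_of_mem (bounded_stdSimplex _) (stdSimplex.vertex i).2
      (stdSimplex.vertex j).2).trans diam_stdSimplex_le
  | succ r ih =>
    classical
    rw [Function.iterate_succ_apply', subdivision_apply] at hτ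
    obtain ⟨ρ, hρ, hτ⟩ := Finset.mem_biUnion.1 (Finsupp.support_finsetSum hτ)
    obtain ⟨σ, hσ, w, rfl, hw⟩ := ih hρ
    dsimp only at hτ
    rw [affineAction_comp_affineMap, affinePush_affineSubdivision, affinePush_vertices] at hτ
    obtain ⟨u, hu, rfl⟩ := mem_support_affineAction hτ
    refine ⟨σ, hσ, u, rfl, fun i j => ?_⟩
    rw [pow_succ']
    exact dist_affineSubdivision_le le_rfl (by positivity) hw hu i j

lemma exists_iterate_subdivision_small {ι : Type*} {U : ι → Set X} (hU : ∀ i, IsOpen (U i))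
    (hcov : ∀ x, ∃ i, x ∈ U i) (z : SingularSimplex X (n + 1) →₀ M) :
    ∃ r, ∀ τ ∈ ((subdivision X M (n + 1))^[r] z).support, ∃ i, ∀ p, τ p ∈ U i := by
  -- Stated for all large `r`, so that one `r` serves the finitely many simplices of `z`.
  have key : ∀ σ : SingularSimplex X (n + 1), ∀ᶠ r : ℕ in Filter.atTop,
      ∀ w : Tuple (n + 1) (n + 1), (∀ i j, dist (w i) (w j) ≤ ((n : ℝ) / (n + 1)) ^ r) →
        ∃ i, ∀ p, σ (affineMap w p) ∈ U i := by
    intro σ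
    obtain ⟨δ, hδ, h⟩ := lebesgue_number_lemma_of_metric (c := fun i => σ ⁻¹' U i) isCompact_univ
      (fun i => (hU i).preimage σ.continuous) fun p _ => Set.mem_iUnion.2 (hcov (σ p))
    have hlim := tendsto_pow_atTop_nhds_zero_of_lt_one (r := (n : ℝ) / (n + 1)) (by positivity)
      (by rw [div_lt_one (by positivity)]; linarith)
    filter_upwards [hlim.eventually (gt_mem_nhds hδ)] with r hr w hw
    obtain ⟨i, hi⟩ := h (w 0) (Set.mem_univ _)
    refine ⟨i, fun p => hi ?_⟩
    -- All vertices lie in the δ-ball around `w 0`, hence so does the affine simplex.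
    exact affineMap_mem_of_convex (convex_ball (w 0 : Fin (n + 1) → ℝ) δ)
      (fun j => (hw j 0).trans_lt hr) p
  obtain ⟨r, hr⟩ := ((Filter.eventually_all_finset z.support).2 fun σ _ => key σ).exists
  refine ⟨r, fun τ hτ => ?_⟩
  obtain ⟨σ, hσ, w, rfl, hw⟩ := mem_support_iterate_subdivision z r hτ
  exact hr σ hσ w hw

end Small

/-! ### The simplex as a quotient of [0,1] times its facet opposite to vertex 0. -/

section Join

variable {n : ℕ}

/-- The point of a simplex at a given position on the segment joining a point of the face opposite
to the vertex `0` to the vertex `0`. -/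
noncomputable def join (x : unitInterval × stdSimplex ℝ (Fin n)) : stdSimplex ℝ (Fin (n + 1)) :=
  ⟨Fin.cons (x.1 : ℝ) fun i => (1 - (x.1 : ℝ)) * x.2 i, by
    refine ⟨Fin.cases x.1.2.1 fun i => mul_nonneg (sub_nonneg.2 x.1.2.2) (x.2.2.1 i), ?_⟩
    · simp [Fin.sum_univ_succ, ← Finset.mul_sum]⟩

lemma join_zero (x : unitInterval × stdSimplex ℝ (Fin n)) : join x 0 = x.1 := rfl

lemma join_succ (x : unitInterval × stdSimplex ℝ (Fin n)) (i : Fin n) :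
    join x i.succ = (1 - (x.1 : ℝ)) * x.2 i := rfl

lemma continuous_join : Continuous (join (n := n)) := by
  refine Continuous.subtype_mk (continuous_pi (Fin.cases ?_ fun i => ?_)) _
  · exact continuous_subtype_val.comp continuous_fst
  · refine (continuous_const.sub (continuous_subtype_val.comp continuous_fst)).mul ?_
    exact (continuous_apply i).comp (continuous_subtype_val.comp continuous_snd)

lemma join_surjective : Function.Surjective (join (n := n + 1)) := by
  intro p
  by_cases h : p 0 = 1
  -- Over the apex any point of the base will do, but the base must be nonempty.
  · refine ⟨(1, stdSimplex.barycenter), ?_⟩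
    have hs := stdSimplex.sum_eq_one p
    rw [Fin.sum_univ_succ, h, add_eq_left,
      Finset.sum_eq_zero_iff_of_nonneg fun i _ => p.2.1 i.succ] at hs
    ext i
    refine Fin.cases ?_ (fun i => ?_) i
    · exact h.symm
    · rw [join_succ, hs i (Finset.mem_univ i)]
      simp
  · have h1 : 1 - p 0 ≠ 0 := sub_ne_zero.2 (Ne.symm h)
    have h2 : 0 ≤ 1 - p 0 := sub_nonneg.2 (stdSimplex.le_one p 0)
    have hs := stdSimplex.sum_eq_one p
    rw [Fin.sum_univ_succ] at hs
    refine ⟨(⟨p 0, p.2.1 0, stdSimplex.le_one p 0⟩, ⟨fun i => p i.succ / (1 - p 0),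
      fun i => div_nonneg (p.2.1 _) h2, ?_⟩), ?_⟩
    · rw [← Finset.sum_div, div_eq_one_iff_eq h1]
      linarith
    · ext i
      refine Fin.cases rfl (fun i => ?_) i
      rw [join_succ]
      exact mul_div_cancel₀ _ h1

lemma eq_of_join_eq {x y : unitInterval × stdSimplex ℝ (Fin n)} (h : join x = join y) :
    x.1 = y.1 ∧ (x.1 = 1 ∨ x.2 = y.2) := by
  have h0 : x.1 = y.1 := Subtype.ext (congrArg (fun p : stdSimplex ℝ (Fin (n + 1)) => p 0) h)
  refine ⟨h0, or_iff_not_imp_left.2 fun h1 => ?_⟩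
  ext i
  have hi := congrArg (fun p : stdSimplex ℝ (Fin (n + 1)) => p i.succ) h
  simp only [join_succ, ← h0] at hi
  refine mul_left_cancel₀ (sub_ne_zero.2 fun h2 => h1 (Subtype.ext h2.symm)) hi

lemma map_succ_eq_join (p : stdSimplex ℝ (Fin n)) :
    stdSimplex.map (Fin.succ : Fin n → Fin (n + 1)) p = join (0, p) := by
  ext i
  rw [stdSimplex.map_coe, FunOnFinite.linearMap_apply_apply]
  refine Fin.cases ?_ (fun i => ?_) i
  · rw [join_zero]
    exact Finset.sum_eq_zero fun j hj => absurd (Finset.mem_filter.1 hj).2 (Fin.succ_ne_zero j)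
  · rw [join_succ]
    simp [Finset.filter_eq']

lemma map_succAbove_join (i : Fin (n + 1)) (x : unitInterval × stdSimplex ℝ (Fin n)) :
    stdSimplex.map i.succ.succAbove (join x) = join (x.1, stdSimplex.map i.succAbove x.2) := by
  ext j
  rw [stdSimplex.map_coe, FunOnFinite.linearMap_apply_apply, Finset.sum_filter,
    Fin.sum_univ_succ]
  refine Fin.cases ?_ (fun j => ?_) j
  · simp [join_zero, Fin.succ_ne_zero]
  · rw [join_succ, stdSimplex.map_coe, FunOnFinite.linearMap_apply_apply, Finset.sum_filter,
      Finset.mul_sum]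
    simp [join_succ, Fin.succ_ne_zero, (Fin.succ_ne_zero _).symm]

end Join

/-! ### Cones on singular simplices along a contraction. -/

section Cone

variable {X : Type*} [TopologicalSpace X] {B : Set X} {n : ℕ}

/-- A map `G : X × [0,1] → X` which contracts each of the subsets `F b` to the point `b`, in such
a way that nothing but the apex is mapped to a point of `B` before time `1`. -/
structure IsContraction (F : B → Set X) (G : X × unitInterval → X) : Prop where
  continuousOn (b : B) : ContinuousOn G (F b ×ˢ Set.univ)
  apply_zero {b : B} {x : X} : x ∈ F b → G (x, 0) = x
  apply_one {b : B} {x : X} : x ∈ F b → G (x, 1) = b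
  mem_iff {b : B} {x : X} (t : unitInterval) : x ∈ F b → (G (x, t) ∈ B ↔ x ∈ B ∨ t = 1)

/-- The simplices which are contained in one of the sets of a family. -/
def containedSimplices (F : B → Set X) (n : ℕ) : Set (SingularSimplex X n) :=
  {σ | ∃ b, ∀ p, σ p ∈ F b}

lemma reindex_mem_containedSimplices {F : B → Set X} {m : ℕ} {σ : SingularSimplex X n}
    (hσ : σ ∈ containedSimplices F n) (f : Fin m → Fin n) :
    σ.reindex f ∈ containedSimplices F m :=
  ⟨hσ.choose, fun _ => hσ.choose_spec _⟩

/-- The underlying function of the cone on a singular simplex. -/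
noncomputable def coneFun (G : X × unitInterval → X) (σ : SingularSimplex X (n + 1))
    (p : stdSimplex ℝ (Fin (n + 2))) : X :=
  G (σ (Function.surjInv join_surjective p).2, (Function.surjInv join_surjective p).1)

open Classical in
/-- The cone on a singular simplex, along which the simplex is contracted. It is a junk value if
the simplex is not contractible in this way. -/
noncomputable def coneSimplex (G : X × unitInterval → X) (σ : SingularSimplex X (n + 1)) :
    SingularSimplex X (n + 2) :=
  if h : Continuous (coneFun G σ) then ⟨coneFun G σ, h⟩ else σ.reindex fun _ => 0

variable {F : B → Set X} {G : X × unitInterval → X} (hG : IsContraction F G)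
  {σ : SingularSimplex X (n + 1)} (hσ : σ ∈ containedSimplices F (n + 1))

include hG hσ

/-- The chosen preimage is irrelevant: `join` identifies points only at time 1, where G is constant
on F b. -/
lemma coneFun_join (x : unitInterval × stdSimplex ℝ (Fin (n + 1))) :
    coneFun G σ (join x) = G (σ x.2, x.1) := by
  obtain ⟨b, hb⟩ := hσ
  obtain ⟨h1, h2⟩ := eq_of_join_eq (Function.surjInv_eq join_surjective (join x))
  rw [coneFun]
  rcases h2 with h2 | h2
  · rw [← h1, h2, hG.apply_one (hb _), hG.apply_one (hb _)]
  · rw [h1, h2]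

/-- `join` maps a compact space onto a Hausdorff one, so it is a quotient map and continuity can be
tested on the product. -/
lemma continuous_coneFun : Continuous (coneFun G σ) := by
  have hq : IsQuotientMap (join (n := n + 1)) :=
    continuous_join.isClosedMap.isQuotientMap continuous_join join_surjective
  rw [hq.continuous_iff]
  have h : coneFun G σ ∘ join = fun x => G (σ x.2, x.1) := funext (coneFun_join hG hσ)
  rw [h]
  obtain ⟨b, hb⟩ := hσ
  exact (hG.continuousOn b).comp_continuous (by fun_prop) fun x => ⟨hb _, Set.mem_univ _⟩

lemma coneSimplex_join (x : unitInterval × stdSimplex ℝ (Fin (n + 1))) :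
    coneSimplex G σ (join x) = G (σ x.2, x.1) := by
  rw [coneSimplex, dif_pos (continuous_coneFun hG hσ)]
  exact coneFun_join hG hσ x

lemma coneSimplex_reindex_zero : (coneSimplex G σ).reindex (Fin.succAbove 0) = σ := by
  ext p
  rw [SingularSimplex.reindex_apply, Fin.succAbove_zero, map_succ_eq_join,
    coneSimplex_join hG hσ]
  exact hG.apply_zero (hσ.choose_spec p)

lemma coneSimplex_mem_admissibleSimplices (hadm : σ ∈ admissibleSimplices B (n + 1)) :
    coneSimplex G σ ∈ admissibleSimplices B (n + 2) := by
  obtain ⟨𝓕, h⟩ := hadm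
  -- The faces are the apex, needed even when σ avoids B, and the joins of the apex with the faces
  -- mapped to B by σ.
  refine ⟨insert {0} ((fun I => insert 0 (Fin.succ '' I)) '' 𝓕), ?_⟩
  ext p
  obtain ⟨⟨t, q⟩, rfl⟩ := join_surjective p
  have hB : σ q ∈ B ↔ ∃ I ∈ 𝓕, ∀ i, i ∉ I → q i = 0 := by
    rw [← Set.mem_preimage, h]
    simp
  have ht : t = 1 ↔ (1 - (t : ℝ)) = 0 := by
    rw [sub_eq_zero, Subtype.ext_iff]
    exact eq_comm
  have hface : ∀ I : Set (Fin (n + 1)),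
      (∀ i, i ∉ insert 0 (Fin.succ '' I) → join (t, q) i = 0) ↔
        t = 1 ∨ ∀ i, i ∉ I → q i = 0 := by
    intro I
    rw [Fin.forall_fin_succ]
    simp only [Set.mem_insert_iff, true_or, not_true_eq_false, false_imp_iff, true_and,
      Fin.succ_ne_zero, false_or, (Fin.succ_injective _).mem_set_image, join_succ, mul_eq_zero,
      ← ht]
    by_cases h1 : t = 1 <;> simp [h1]
  have h0 : (∀ i, i ∉ ({0} : Set (Fin (n + 2))) → join (t, q) i = 0) ↔ t = 1 := by
    have := hface ∅
    rw [Set.image_empty, insert_empty_eq] at this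
    rw [this]
    -- The coordinates of q sum to 1, so they cannot all vanish.
    refine or_iff_left fun hq => ?_
    have := stdSimplex.sum_eq_one q
    simp [hq] at this
  rw [Set.mem_preimage, coneSimplex_join hG hσ, hG.mem_iff t (hσ.choose_spec q), hB,
    Set.biUnion_insert, Set.biUnion_image]
  simp only [Set.mem_union, Set.mem_iUnion, Set.mem_ofPred_eq, h0, hface, exists_prop]
  constructor
  · rintro (⟨I, hI, hq⟩ | h1)
    · exact Or.inr ⟨I, hI, Or.inr hq⟩
    · exact Or.inl h1
  · rintro (h1 | ⟨I, hI, h1 | hq⟩)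
    · exact Or.inr h1
    · exact Or.inr h1
    · exact Or.inl ⟨I, hI, hq⟩

omit hσ in
lemma coneSimplex_reindex_succ {σ : SingularSimplex X (n + 2)}
    (hσ : σ ∈ containedSimplices F (n + 2)) (i : Fin (n + 2)) :
    (coneSimplex G σ).reindex i.succ.succAbove = coneSimplex G (σ.reindex i.succAbove) := by
  ext p
  obtain ⟨x, rfl⟩ := join_surjective p
  rw [SingularSimplex.reindex_apply, map_succAbove_join, coneSimplex_join hG hσ,
    coneSimplex_join hG (reindex_mem_containedSimplices hσ _)]
  rfl

end Cone

/-! ### Chains with admissible boundary are admissible up to boundaries. -/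

section Acyclicity

variable {X : Type*} [TopologicalSpace X] {B : Set X} {M : Type*} [AddCommGroup M] {n : ℕ}

lemma IsMarkedSpace.exists_isContraction (hB : IsMarkedSpace B) :
    ∃ (F : B → Set X) (G : X × unitInterval → X), (∀ b : B, F b ∈ 𝓝 (b : X)) ∧
      IsContraction F G := by
  classical
  obtain ⟨F, hF, hdisj⟩ := hB.exists_nhds
  have huniq : ∀ {b b' : B} {x : X}, x ∈ F b → x ∈ F b' → b = b' := by
    intro b b' x hx hx'
    by_contra hne
    exact Set.disjoint_left.1 (hdisj hne) hx hx'
  choose hb H h0 h1 hpre using fun b => (hF b).2.2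
  -- The homotopies glue because the F b are disjoint. Outside their union the value is arbitrary,
  -- and G need not be continuous globally.
  let G : X × unitInterval → X := fun y =>
    if h : ∃ b, y.1 ∈ F b then H h.choose (⟨y.1, h.choose_spec⟩, y.2) else y.1
  have hGF : ∀ (b : B) (x : X) (hx : x ∈ F b) (t : unitInterval),
      G (x, t) = H b (⟨x, hx⟩, t) := by
    intro b x hx t
    have h : ∃ b, x ∈ F b := ⟨b, hx⟩
    have key : ∀ (b' : B) (hx' : x ∈ F b'), ((H b' (⟨x, hx'⟩, t) : F b') : X) =
        H b (⟨x, hx⟩, t) := by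
      intro b' hx'
      obtain rfl := huniq hx hx'
      rfl
    exact (dif_pos h).trans (key _ h.choose_spec)
  refine ⟨F, G, fun b => (hF b).2.1, ⟨fun b => ?_, fun {b x} hx => ?_, fun {b x} hx => ?_,
    fun {b x} t hx => ?_⟩⟩
  · rw [continuousOn_iff_continuous_domRestrict]
    have : (F b ×ˢ (Set.univ : Set unitInterval)).domRestrict G =
        fun y => ((H b (⟨y.1.1, y.2.1⟩, y.1.2) : F b) : X) :=
      funext fun y => hGF b _ y.2.1 _
    rw [this]
    fun_prop
  · rw [hGF b x hx, h0]
  · rw [hGF b x hx, h1]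
  -- F b meets B only in b: any other point of B lies in its own, disjoint neighbourhood.
  · have hmem : ∀ y : F b, (y : X) ∈ B ↔ y = ⟨b, hb b⟩ := by
      refine fun y => ⟨fun hy => ?_, fun hy => by rw [hy]; exact b.2⟩
      exact Subtype.ext (congrArg (Subtype.val : B → X) (huniq (hb ⟨y, hy⟩) y.2))
    rw [hGF b x hx, hmem, show x ∈ B ↔ _ from hmem ⟨x, hx⟩]
    have := Set.ext_iff.1 (hpre b) (⟨x, hx⟩, t)
    simpa using this

/-- The cone operator on singular chains. -/
noncomputable def singularCone (M : Type*) [AddCommGroup M] (G : X × unitInterval → X) (n : ℕ) :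
    (SingularSimplex X (n + 1) →₀ M) →ₗ[ℤ] (SingularSimplex X (n + 2) →₀ M) :=
  Finsupp.lmapDomain M ℤ (coneSimplex G)

lemma singularBoundary_singularCone {F : B → Set X} {G : X × unitInterval → X}
    (hG : IsContraction F G) {z : SingularSimplex X (n + 2) →₀ M}
    (hz : z ∈ Finsupp.supported M ℤ (containedSimplices F (n + 2))) :
    singularBoundary X M (n + 2) (singularCone M G (n + 1) z) =
      z - singularCone M G n (singularBoundary X M (n + 1) z) := by
  have h : ∀ σ ∈ z.support, singularBoundary X M (n + 2) (singularCone M G (n + 1)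
      (Finsupp.single σ (z σ))) = Finsupp.single σ (z σ) - singularCone M G n
        (singularBoundary X M (n + 1) (Finsupp.single σ (z σ))) := fun σ hσ =>
    altSum_cone (coneSimplex_reindex_zero hG (hz hσ)) (coneSimplex_reindex_succ hG (hz hσ)) _
  rw [← z.sum_single, Finsupp.sum]
  simp only [map_sum]
  rw [Finset.sum_congr rfl h, Finset.sum_sub_distrib]

lemma singularCone_mem_admissible {F : B → Set X} {G : X × unitInterval → X}
    (hG : IsContraction F G) {z : SingularSimplex X (n + 1) →₀ M}
    (hz : z ∈ Finsupp.supported M ℤ (containedSimplices F (n + 1)))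
    (hadm : z ∈ Finsupp.supported M ℤ (admissibleSimplices B (n + 1))) :
    singularCone M G n z ∈ Finsupp.supported M ℤ (admissibleSimplices B (n + 2)) := by
  classical
  intro τ hτ
  obtain ⟨σ, hσ, rfl⟩ := Finset.mem_image.1 (Finsupp.mapDomain_support hτ)
  exact coneSimplex_mem_admissibleSimplices hG (hz hσ) (hadm hσ)

/-- With z = z₁ + z₂ split into admissible and non-admissible parts, z − ∂Cz₂ = z₁ + C∂z₂. Here ∂z₂
= ∂z − ∂z₁ is admissible, and C preserves this. -/
lemma exists_sub_singularBoundary_mem_of_small {F : B → Set X} {G : X × unitInterval → X}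
    (hG : IsContraction F G) {z : SingularSimplex X (n + 2) →₀ M}
    (hz : z ∈ Finsupp.supported M ℤ
      (admissibleSimplices B (n + 2) ∪ containedSimplices F (n + 2)))
    (hbd : singularBoundary X M (n + 1) z ∈ Finsupp.supported M ℤ (admissibleSimplices B (n + 1))) :
    ∃ w, z - singularBoundary X M (n + 2) w ∈
      Finsupp.supported M ℤ (admissibleSimplices B (n + 2)) := by
  classical
  set z₁ := z.filter (· ∈ admissibleSimplices B (n + 2))
  set z₂ := z.filter (· ∉ admissibleSimplices B (n + 2))
  have hadd : z₁ + z₂ = z := Finsupp.filter_add_filter_not _ _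
  have h1 : z₁ ∈ Finsupp.supported M ℤ (admissibleSimplices B (n + 2)) := fun σ hσ => by
    rw [Finset.mem_coe, Finsupp.support_filter] at hσ
    exact (Finset.mem_filter.1 hσ).2
  have h2 : z₂ ∈ Finsupp.supported M ℤ (containedSimplices F (n + 2)) := fun σ hσ => by
    rw [Finset.mem_coe, Finsupp.support_filter, Finset.mem_filter] at hσ
    exact (hz hσ.1).resolve_left hσ.2
  have h3 : singularBoundary X M (n + 1) z₂ ∈
      Finsupp.supported M ℤ (admissibleSimplices B (n + 1)) := by
    rw [← hadd, map_add] at hbd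
    exact (Submodule.add_mem_iff_right _ (singularBoundary_mem_admissible h1)).1 hbd
  refine ⟨singularCone M G (n + 1) z₂, ?_⟩
  rw [singularBoundary_singularCone hG h2, ← hadd, add_sub_assoc, sub_sub_cancel]
  refine Submodule.add_mem _ h1 (singularCone_mem_admissible hG ?_ h3)
  exact altSum_mem_supported (fun σ hσ i => reindex_mem_containedSimplices hσ _) h2

theorem IsMarkedSpace.exists_sub_singularBoundary_mem (hB : IsMarkedSpace B)
    (z : SingularSimplex X (n + 2) →₀ M)
    (hbd : singularBoundary X M (n + 1) z ∈ Finsupp.supported M ℤ (admissibleSimplices B (n + 1))) :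
    ∃ w, z - singularBoundary X M (n + 2) w ∈
      Finsupp.supported M ℤ (admissibleSimplices B (n + 2)) := by
  obtain ⟨F, G, hF, hG⟩ := hB.exists_isContraction
  -- The open cover by the complement of B (`none`) and the interiors of the F b.
  let U : Option B → Set X := fun i => i.elim Bᶜ fun b => interior (F b)
  have hU : ∀ i, IsOpen (U i) := by
    rintro (_ | b)
    · exact hB.isClosed.isOpen_compl
    · exact isOpen_interior
  have hcov : ∀ x, ∃ i, x ∈ U i := fun x => by
    by_cases hx : x ∈ B
    · exact ⟨some ⟨x, hx⟩, mem_interior_iff_mem_nhds.2 (hF ⟨x, hx⟩)⟩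
    · exact ⟨none, hx⟩
  obtain ⟨r, hr⟩ := exists_iterate_subdivision_small hU hcov z
  obtain ⟨h1, w, hw⟩ := exists_sub_singularBoundary_of_iterate hbd r
  obtain ⟨w', hw'⟩ := exists_sub_singularBoundary_mem_of_small hG (fun τ hτ => by
    obtain ⟨_ | b, hi⟩ := hr τ hτ
    · exact Or.inl (mem_admissibleSimplices_of_disjoint hi)
    · exact Or.inr ⟨b, fun p => interior_subset (hi p)⟩) h1
  refine ⟨w + w', ?_⟩
  convert Submodule.add_mem _ hw hw' using 1
  rw [map_add]
  abel

end Acyclicity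

/-! ### Homological algebra of cokernels. -/

section QuasiIso

variable {R : Type v} [Ring R] {K L : ChainComplex (ModuleCat.{max u v} R) ℕ}

/-- The short complex formed by a morphism of chain complexes and its cokernel. -/
noncomputable abbrev cokernelShortComplex (φ : K ⟶ L) :
    ShortComplex (ChainComplex (ModuleCat.{max u v} R) ℕ) :=
  ShortComplex.mk φ (cokernel.π φ) (cokernel.condition φ)

lemma cokernelShortComplex_shortExact (φ : K ⟶ L) [Mono φ] :
    (cokernelShortComplex φ).ShortExact where
  exact := ShortComplex.exact_cokernel φ
  mono_f := inferInstance
  epi_g := inferInstance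

lemma quasiIso_of_acyclic_cokernel (φ : K ⟶ L) [Mono φ] (h : (cokernel φ).Acyclic) :
    QuasiIso φ := by
  have hS := cokernelShortComplex_shortExact φ
  rw [quasiIso_iff]
  intro i
  rw [quasiIsoAt_iff_isIso_homologyMap]
  have : Epi (HomologicalComplex.homologyMap φ i) :=
    (hS.homology_exact₂ i).epi_f ((h i).isZero_homology.eq_of_tgt _ _)
  have : Mono (HomologicalComplex.homologyMap φ i) :=
    (hS.homology_exact₁ (i + 1) i rfl).mono_g ((h (i + 1)).isZero_homology.eq_of_src _ _)
  exact isIso_of_mono_of_epi _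

lemma quasiIso_cokernel_map {P : ChainComplex (ModuleCat.{max u v} R) ℕ} (i : P ⟶ K) (j : P ⟶ L)
    (φ : K ⟶ L) [Mono i] [Mono j] (hφ : QuasiIso φ) (w : i ≫ φ = 𝟙 P ≫ j) :
    QuasiIso (cokernel.map i j (𝟙 P) φ w) := by
  let ψ : cokernelShortComplex i ⟶ cokernelShortComplex j :=
    { τ₁ := 𝟙 P
      τ₂ := φ
      τ₃ := cokernel.map i j (𝟙 P) φ w
      comm₁₂ := w.symm
      comm₂₃ := (cokernel.π_desc _ _ _).symm }
  have h₁ : QuasiIso ψ.τ₁ := inferInstanceAs (QuasiIso (𝟙 P))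
  exact HomologicalComplex.HomologySequence.quasiIso_τ₃ ψ (cokernelShortComplex_shortExact i)
    (cokernelShortComplex_shortExact j) h₁ hφ

/-- A degreewise injective morphism of chain complexes is a quasi-isomorphism if every chain with
boundary in its range is congruent to a boundary modulo its range. -/
lemma quasiIso_of_exists_sub_mem_range (φ : K ⟶ L) (hφ : ∀ n, Function.Injective (φ.f n))
    (h0 : Function.Surjective (φ.f 0))
    (h : ∀ n (z : L.X (n + 1)), L.d (n + 1) n z ∈ LinearMap.range (φ.f n).hom →
      ∃ w : L.X (n + 2), z - L.d (n + 2) (n + 1) w ∈ LinearMap.range (φ.f (n + 1)).hom) :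
    QuasiIso φ := by
  have hm : ∀ n, Mono (φ.f n) := fun n => (ModuleCat.mono_iff_injective _).2 (hφ n)
  have : Mono φ := HomologicalComplex.mono_of_mono_f φ hm
  have hS := cokernelShortComplex_shortExact φ
  have hsurj : ∀ n, Function.Surjective ((cokernel.π φ).f n) := fun n =>
    (ModuleCat.epi_iff_surjective _).1 inferInstance
  have hker : ∀ n (x : L.X n), (cokernel.π φ).f n x = 0 → x ∈ LinearMap.range (φ.f n).hom := by
    intro n x hx
    have := hS.exact.map (HomologicalComplex.eval (ModuleCat.{max u v} R) (ComplexShape.down ℕ) n)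
    exact (ShortComplex.moduleCat_exact_iff _).1 this x hx
  have hrange : ∀ n (x : K.X n), (cokernel.π φ).f n (φ.f n x) = 0 := by
    intro n x
    have := HomologicalComplex.congr_hom (cokernel.condition φ) n
    exact congr($this x)
  have hcomm : ∀ i j (x : L.X i), (cokernel φ).d i j ((cokernel.π φ).f i x) =
      (cokernel.π φ).f j (L.d i j x) := fun i j x => congr($((cokernel.π φ).comm i j) x)
  refine quasiIso_of_acyclic_cokernel φ fun i => ?_
  cases i with
  | zero =>
    refine ShortComplex.exact_of_isZero_X₂ _ ?_
    refine @ModuleCat.isZero_of_subsingleton _ _ _ ⟨fun x y => ?_⟩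
    have : ∀ x : (cokernel φ).X 0, x = 0 := fun x => by
      obtain ⟨x, rfl⟩ := hsurj 0 x
      obtain ⟨x, rfl⟩ := h0 x
      exact hrange 0 x
    exact (this x).trans (this y).symm
  | succ n =>
    rw [HomologicalComplex.exactAt_iff' _ (n + 2) (n + 1) n (by simp) (by simp),
      ShortComplex.moduleCat_exact_iff]
    intro x hx
    obtain ⟨x, rfl⟩ := hsurj (n + 1) x
    -- A cycle of the cokernel lifts to a chain with boundary in the range of φ.
    obtain ⟨w, y, hy⟩ := h n x (hker n _ ((hcomm _ _ _).symm.trans hx))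
    refine ⟨(cokernel.π φ).f (n + 2) w, (hcomm _ _ _).trans ?_⟩
    rw [eq_comm, ← sub_eq_zero, ← map_sub]
    change _ = _ at hy
    rw [← hy]
    exact hrange _ y

end QuasiIso

/-! ### Simplicial chains as finitely supported functions. -/

section Chains

variable {R : Type v} [Ring R] (K : SSet.{u}) (N : ModuleCat.{max u v} R) (n : ℕ)

open Simplicial

/-- Simplicial chains are finitely supported functions on the simplices. -/
noncomputable def chainEquiv : (K _⦋n⦌ →₀ N) ≃ₗ[R] (K.chainComplex N).X n :=
  -- The scalars are `ℕ` because a noncommutative `R` need not act on linear maps.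
  let f := Finsupp.lsum ℕ fun x : K _⦋n⦌ => (K.ιChainComplex (R := N) x).hom
  let g : (K.chainComplex N).X n ⟶ ModuleCat.of R (K _⦋n⦌ →₀ N) :=
    Cofan.IsColimit.desc (K.isColimitChainComplexXCofan N n)
      fun x => ModuleCat.ofHom (Finsupp.lsingle x)
  have hg : ∀ x, K.ιChainComplex x ≫ g = ModuleCat.ofHom (Finsupp.lsingle x) := fun x =>
    Cofan.IsColimit.fac (K.isColimitChainComplexXCofan N n) _ x
  LinearEquiv.ofLinearMap f g.hom
    (by
      have : g ≫ ModuleCat.ofHom f = 𝟙 _ := by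
        refine SSet.chainComplex_hom_ext fun x => ?_
        rw [← Category.assoc, hg, Category.comp_id]
        ext a
        exact Finsupp.lsum_single ℕ (fun x : K _⦋n⦌ => (K.ιChainComplex (R := N) x).hom) x a
      exact congrArg ModuleCat.Hom.hom this)
    (by
      refine Finsupp.lhom_ext' fun x => LinearMap.ext fun a => ?_
      change g.hom (f (Finsupp.single x a)) = Finsupp.single x a
      rw [Finsupp.lsum_single]
      exact congr($(hg x) a))

variable {K N n}

lemma chainEquiv_single (x : K _⦋n⦌) (a : N) :
    chainEquiv K N n (Finsupp.single x a) = K.ιChainComplex (R := N) x a :=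
  Finsupp.lsum_single _ _ _ _

lemma d_chainEquiv (z : K _⦋n + 1⦌ →₀ N) :
    (K.chainComplex N).d (n + 1) n (chainEquiv K N (n + 1) z) =
      chainEquiv K N n (altSum (fun i x => K.δ i x) z) := by
  induction z using Finsupp.induction_linear with
  | zero => simp
  | add z z' h h' => simp only [map_add, h, h']
  | single x a =>
    rw [chainEquiv_single, altSum_single, map_sum]
    have := congr($(K.ιChainComplex_d N x) a)
    refine this.trans ?_
    simp [chainEquiv_single, ModuleCat.hom_sum]

lemma chainComplexMap_chainEquiv {K' : SSet.{u}} (f : K ⟶ K') (z : K _⦋n⦌ →₀ N) :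
    (SSet.chainComplexMap f N).f n (chainEquiv K N n z) =
      chainEquiv K' N n (Finsupp.mapDomain (f.app _) z) := by
  induction z using Finsupp.induction_linear with
  | zero => simp
  | add z z' h h' => simp only [map_add, h, h', Finsupp.mapDomain_add]
  | single x a =>
    rw [chainEquiv_single, Finsupp.mapDomain_single, chainEquiv_single]
    exact congr($(K.ι_chainComplexMap_f K' f N x) a)

lemma injective_chainComplexMap {K' : SSet.{u}} (f : K ⟶ K')
    (hf : ∀ n : ℕ, Function.Injective (f.app (Opposite.op ⦋n⦌))) (n : ℕ) :
    Function.Injective ((SSet.chainComplexMap f N).f n) := by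
  intro x y h
  obtain ⟨x, rfl⟩ := (chainEquiv K N n).surjective x
  obtain ⟨y, rfl⟩ := (chainEquiv K N n).surjective y
  rw [chainComplexMap_chainEquiv, chainComplexMap_chainEquiv] at h
  rw [Finsupp.mapDomain_injective (hf n) ((chainEquiv K' N n).injective h)]

lemma mono_chainComplexMap {K' : SSet.{u}} (f : K ⟶ K')
    (hf : ∀ n : ℕ, Function.Injective (f.app (Opposite.op ⦋n⦌))) :
    Mono (SSet.chainComplexMap f N) :=
  HomologicalComplex.mono_of_mono_f _ fun n =>
    (ModuleCat.mono_iff_injective _).2 (injective_chainComplexMap f hf n)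

lemma chainEquiv_mem_range_iff (A : K.Subcomplex) (z : K _⦋n⦌ →₀ N) :
    chainEquiv K N n z ∈ LinearMap.range ((SSet.chainComplexMap A.ι N).f n).hom ↔
      z ∈ Finsupp.supported N ℤ (A.obj (Opposite.op ⦋n⦌)) := by
  rw [← Subtype.range_coe (s := A.obj (Opposite.op ⦋n⦌)), ← Set.image_univ,
    ← Finsupp.lmapDomain_supported N ℤ, Finsupp.supported_univ, Submodule.map_top]
  constructor
  · rintro ⟨y, hy⟩
    obtain ⟨y, rfl⟩ := (chainEquiv _ N n).surjective y
    exact ⟨y, (chainEquiv K N n).injective ((chainComplexMap_chainEquiv A.ι y).symm.trans hy)⟩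
  · rintro ⟨y, rfl⟩
    exact ⟨chainEquiv _ N n y, chainComplexMap_chainEquiv A.ι y⟩

end Chains

/-! ### Transfer to the singular simplicial set: n-simplices have n + 1 vertices. -/

section Singular

variable {R : Type v} [Ring R] {X : Type u} [TopologicalSpace X] (N : ModuleCat.{max u v} R) (n : ℕ)

open Simplicial

/-- Chains in the singular simplicial set are singular chains. -/
noncomputable def singularChainEquiv : (SingularSimplex X (n + 1) →₀ N) ≃ₗ[R]
    ((TopCat.toSSet.obj (TopCat.of X)).chainComplex N).X n :=
  (Finsupp.domLCongr ((TopCat.of X).toSSetObjEquiv (Opposite.op ⦋n⦌)).symm).trans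
    (chainEquiv _ N n)

variable {N n}

lemma d_singularChainEquiv (z : SingularSimplex X (n + 2) →₀ N) :
    ((TopCat.toSSet.obj (TopCat.of X)).chainComplex N).d (n + 1) n
      (singularChainEquiv N (n + 1) z) =
        singularChainEquiv N n (singularBoundary X N (n + 1) z) := by
  refine (d_chainEquiv _).trans ?_
  rw [singularChainEquiv, LinearEquiv.trans_apply]
  congr 1
  induction z using Finsupp.induction_linear with
  | zero => simp
  | add z z' h h' => simp only [map_add, h, h']
  | single σ a =>
    change altSum _ (Finsupp.domLCongr (R := R) _ (Finsupp.single σ a)) = _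
    rw [singularBoundary, altSum_single, map_sum, Finsupp.domLCongr_single, altSum_single]
    refine Finset.sum_congr rfl fun i _ => ?_
    rw [map_zsmul, Finsupp.domLCongr_single]
    rfl

lemma singularChainEquiv_mem_range_iff (B : Set X) (z : SingularSimplex X (n + 1) →₀ N) :
    singularChainEquiv N n z ∈
        LinearMap.range ((SSet.chainComplexMap (admissibleSubcomplex B).ι N).f n).hom ↔
      z ∈ Finsupp.supported N ℤ (admissibleSimplices B (n + 1)) := by
  rw [singularChainEquiv, LinearEquiv.trans_apply, chainEquiv_mem_range_iff]
  constructor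
  · intro h σ hσ
    have hmem : ((TopCat.of X).toSSetObjEquiv (Opposite.op ⦋n⦌)).symm σ ∈
        (admissibleSubcomplex B).obj (Opposite.op ⦋n⦌) := h (by simpa using hσ)
    change ((TopCat.of X).toSSetObjEquiv (Opposite.op ⦋n⦌)
      (((TopCat.of X).toSSetObjEquiv (Opposite.op ⦋n⦌)).symm σ)) ∈
        admissibleSimplices B (n + 1) at hmem
    rwa [Equiv.apply_symm_apply] at hmem
  · intro h s hs
    have hmem : (TopCat.of X).toSSetObjEquiv (Opposite.op ⦋n⦌) s ∈
        admissibleSimplices B (n + 1) := h (by simpa using hs)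
    exact hmem

theorem IsMarkedSpace.quasiIso_admissible {B : Set X} (hB : IsMarkedSpace B) :
    QuasiIso (SSet.chainComplexMap (admissibleSubcomplex B).ι N) := by
  refine quasiIso_of_exists_sub_mem_range _
    (injective_chainComplexMap _ fun n => Subtype.val_injective) ?_ ?_
  · intro z
    obtain ⟨z, rfl⟩ := (singularChainEquiv N 0).surjective z
    exact (singularChainEquiv_mem_range_iff B z).2 fun σ _ => mem_admissibleSimplices_one σ
  · intro n z hz
    obtain ⟨z, rfl⟩ := (singularChainEquiv N (n + 1)).surjective z
    rw [d_singularChainEquiv, singularChainEquiv_mem_range_iff] at hz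
    obtain ⟨w, hw⟩ := hB.exists_sub_singularBoundary_mem z hz
    refine ⟨singularChainEquiv N (n + 2) w, ?_⟩
    rwa [d_singularChainEquiv, ← map_sub, singularChainEquiv_mem_range_iff]

lemma injective_singularInclusion_app (B : Set X) (n : ℕ) :
    Function.Injective ((singularInclusion B).app (Opposite.op ⦋n⦌)) := by
  intro s t h
  refine ((TopCat.of B).toSSetObjEquiv (Opposite.op ⦋n⦌)).injective ?_
  ext p
  exact congr((TopCat.of X).toSSetObjEquiv (Opposite.op ⦋n⦌) $h p)

lemma injective_toAdmissible_app (B : Set X) (n : ℕ) :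
    Function.Injective ((toAdmissible B).app (Opposite.op ⦋n⦌)) := by
  intro s t h
  exact injective_singularInclusion_app B n (congrArg Subtype.val h)

theorem IsMarkedSpace.quasiIso_markedInclusion (R : Type v) [Ring R] {B : Set X}
    (hB : IsMarkedSpace B) : QuasiIso (markedInclusion R B) := by
  have := mono_chainComplexMap (N := coeff.{u, v} R) _ (injective_toAdmissible_app B)
  have := mono_chainComplexMap (N := coeff.{u, v} R) _ (injective_singularInclusion_app B)
  refine quasiIso_cokernel_map _ _ _ hB.quasiIso_admissible ?_
  rw [Category.id_comp]
  exact (((SSet.chainComplexFunctor _).obj (coeff.{u, v} R)).map_comp _ _).symm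

end Singular

end MarkedHomology

theorem mainTheorem7 (R : Type v) [Ring R] (X : Type u) [TopologicalSpace X] (B : Set X)
    (hB : MarkedHomology.IsMarkedSpace B) (n : ℕ) :
    IsIso (MarkedHomology.markedHomologyMap R B n) := by
  have := hB.quasiIso_markedInclusion R
  infer_instance
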